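/- Throughout, an extraspecial $p$-group ($p$ prime) is a finite $p$-group $G$ whose center $Z(G)$ is cyclic of order $p$ and whose quotient $G/Z(G)$ is a non-trivial elementary abelian $p$-group. **Computational setting.** The group $G$ is given by a list $S$ of generators, and its elements are represented by normal forms with respect to some polycyclic sequence $x_0,\dots,x_{d-1}$ of $G$: with $G_k=\langle x_k,\dots,x_{d-1}\rangle$, each $G_{k+1}$ is a normal subgroup of $G_k$ of index $r_k>1$, and every $g\in G$ is written uniquely as $g=x_0^{a_0}x_1^{a_1}\cdots x_{d-1}^{a_{d-1}}$ with $0\le a_k<r_k$. (Examples are the normal forms $x^iy^j$ in $C_{p^2}\rtimes C_p$ and $x^iy^jz^k$ in $(C_p\times C_p)\rtimes C_p$.) An algorithm is one program, the same for all $p$, $G$, $S$ and all polycyclic sequences, for a deterministic random access machine with cells for non-negative integers and cells for group elements. It receives $p$, $|S|$, $d$, the two elements of the instance and access to the list $S$. Each of the following counts as one step: multiplication, inversion, copying and equality test of group elements; reading a generator from $S$, a number $r_k$, or an exponent $a_k$ of an element; and writing a constant, copying, comparison, addition, truncated subtraction, integer division, remainder, and multiplication modulo an integer for integers. A running time is the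 number of steps. **Theorem.** The conjugacy search problem in extraspecial $p$-groups has a polynomial time solution: there are an algorithm and a constant $C$ such that, for every prime $p$, every extraspecial $p$-group $G$ given by a list $S$ of generators and normal forms as above, and all conjugate elements $\tilde g, g'\in G$, the algorithm halts after at most $C\,(|S|+\log_2|G|)$ steps and outputs an element $g\in G$ with $g^{-1}\tilde g g=g'$. In particular, its running time is $\mathcal O(\log|G|)$ if the generating list $S$ is irredundant. -/

import Mathlib

/-! ### Extraspecial groups -/

/-- `G` is an extraspecial `p`-group: a finite `p`-group whose center is cyclic of order `p` and
whose central quotient is a non-trivial elementary abelian `p`-group. -/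
structure IsExtraspecial (p : ℕ) (G : Type*) [Group G] : Prop where
  finite : Finite G
  isPGroup : IsPGroup p G
  isCyclic_center : IsCyclic (Subgroup.center G)
  card_center : Nat.card (Subgroup.center G) = p
  nontrivial_quotient : Nontrivial (G ⧸ Subgroup.center G)
  comm_quotient : ∀ a b : G ⧸ Subgroup.center G, a * b = b * a
  pow_quotient : ∀ a : G ⧸ Subgroup.center G, a ^ p = 1

/-! ### Normal forms: elements as words `x₀ ^ a₀ * x₁ ^ a₁ * ⋯ ` -/

/-- The subgroup generated by `x k, x (k + 1), …`. -/
def tailSubgroup {G : Type*} [Group G] {n : ℕ} (x : Fin n → G) (k : ℕ) : Subgroup G :=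
  Subgroup.closure {g | ∃ i : Fin n, k ≤ (i : ℕ) ∧ x i = g}

/-- The order of `x i` modulo the subgroup generated by `x (i + 1), x (i + 2), …`
(for a subnormal sequence as in `PolycyclicRep`). -/
noncomputable def relOrder {G : Type*} [Group G] {n : ℕ} (x : Fin n → G) (i : Fin n) : ℕ :=
  (tailSubgroup x (i + 1)).relIndex (tailSubgroup x i)

/-- A polycyclic generating sequence of a finite group, with the exponents of the normal forms:
with `G k := ⟨x k, x (k + 1), …⟩`, every `G (k + 1)` is normal in `G k` with non-trivial
quotient (cyclic, generated by `x k`) of order `r k`, and every element is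
`x 0 ^ a 0 * x 1 ^ a 1 * ⋯` with `0 ≤ a k < r k`. These exponents `a k = exps g k` are unique. -/
structure PolycyclicRep (G : Type*) [Group G] where
  len : ℕ
  x : Fin len → G
  normal : ∀ i : Fin len,
    ((tailSubgroup x (i + 1)).subgroupOf (tailSubgroup x i)).Normal
  one_lt_relOrder : ∀ i : Fin len, 1 < relOrder x i
  exps : G → Fin len → ℕ
  exps_lt : ∀ g i, exps g i < relOrder x i
  prod_exps : ∀ g, (List.ofFn fun i => x i ^ exps g i).prod = g

/-! ### Random access machines over a group -/

/-- The address of a memory cell: direct, or read from an integer cell. -/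
inductive Addr
  | dir (k : ℕ)
  | ind (k : ℕ)

/-- Elementary instructions; the first address is the target. No instruction but `add` can produce
an integer larger than all integers at hand (in particular there is no multiplication of unbounded
integers), so that `t` steps produce integers of `O(t)` bits beyond the input. -/
inductive Instr
  /-- write a constant -/
  | const (a : Addr) (c : ℕ)
  | copy (a b : Addr)
  | add (a b c : Addr)
  /-- subtraction, cut off at `0` -/
  | sub (a b c : Addr)
  | div (a b c : Addr)
  | mod (a b c : Addr)
  /-- `b * c` modulo `m` -/
  | mulMod (a b c m : Addr)
  /-- read the relative order of the polycyclic generator with the index in cell `i` -/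
  | readOrder (a i : Addr)
  /-- read the exponent of the element in cell `e`, at the index in cell `i` -/
  | readExp (a e i : Addr)
  /-- read the given generator of the group with the index in cell `i` -/
  | readGen (e i : Addr)
  | copyElt (e f : Addr)
  | one (e : Addr)
  | mul (e f h : Addr)
  | inv (e f : Addr)

/-- Tests: comparison of two integer cells, and equality of two group cells. -/
inductive Test
  | lt (a b : Addr)
  | eqElt (e f : Addr)

/-- Structured programs. A program is a finite text and does not refer to any group. -/
inductive Prog
  | skip
  | instr (I : Instr)
  | seq (P Q : Prog)
  | ite (T : Test) (P Q : Prog)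
  | while (T : Test) (P : Prog)

/-- The memory: integer cells and cells that hold group elements. -/
structure Memory (G : Type*) where
  num : ℕ → ℕ
  elt : ℕ → G

namespace Memory

variable {G : Type*}

/-- The cell that an address refers to. -/
def loc (σ : Memory G) : Addr → ℕ
  | .dir k => k
  | .ind k => σ.num k

/-- The integer at an address. -/
def getNum (σ : Memory G) (a : Addr) : ℕ := σ.num (σ.loc a)

/-- The group element at an address. -/
def getElt (σ : Memory G) (a : Addr) : G := σ.elt (σ.loc a)

/-- Write an integer. -/
def setNum (σ : Memory G) (a : Addr) (v : ℕ) : Memory G :=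
  { σ with num := Function.update σ.num (σ.loc a) v }

/-- Write a group element. -/
def setElt (σ : Memory G) (a : Addr) (v : G) : Memory G :=
  { σ with elt := Function.update σ.elt (σ.loc a) v }

end Memory

/-- The effect of one instruction in a group `G` with normal forms `R` and given generators `S`.
Read accesses out of range return `0`, respectively `1`. -/
noncomputable def Instr.run {G : Type*} [Group G] (R : PolycyclicRep G) (S : List G)
    (σ : Memory G) : Instr → Memory G
  | .const a c => σ.setNum a c
  | .copy a b => σ.setNum a (σ.getNum b)
  | .add a b c => σ.setNum a (σ.getNum b + σ.getNum c)
  | .sub a b c => σ.setNum a (σ.getNum b - σ.getNum c)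
  | .div a b c => σ.setNum a (σ.getNum b / σ.getNum c)
  | .mod a b c => σ.setNum a (σ.getNum b % σ.getNum c)
  | .mulMod a b c m => σ.setNum a
      (if σ.getNum m = 0 then 0 else (σ.getNum b * σ.getNum c) % σ.getNum m)
  | .readOrder a i => σ.setNum a
      (if h : σ.getNum i < R.len then relOrder R.x ⟨σ.getNum i, h⟩ else 0)
  | .readExp a e i => σ.setNum a
      (if h : σ.getNum i < R.len then R.exps (σ.getElt e) ⟨σ.getNum i, h⟩ else 0)
  | .readGen e i => σ.setElt e (S.getD (σ.getNum i) 1)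
  | .copyElt e f => σ.setElt e (σ.getElt f)
  | .one e => σ.setElt e 1
  | .mul e f h => σ.setElt e (σ.getElt f * σ.getElt h)
  | .inv e f => σ.setElt e (σ.getElt f)⁻¹

/-- The outcome of a test. -/
def Test.holds {G : Type*} (σ : Memory G) : Test → Prop
  | .lt a b => σ.getNum a < σ.getNum b
  | .eqElt e f => σ.getElt e = σ.getElt f

/-- `Exec R S P σ τ t`: program `P`, started on the memory `σ`, halts on the memory `τ` after
exactly `t` steps, where each executed instruction and each evaluated test is one step. -/
inductive Exec {G : Type*} [Group G] (R : PolycyclicRep G) (S : List G) :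
    Prog → Memory G → Memory G → ℕ → Prop
  | skip (σ : Memory G) : Exec R S .skip σ σ 0
  | instr (I : Instr) (σ : Memory G) : Exec R S (.instr I) σ (I.run R S σ) 1
  | seq {P Q : Prog} {σ τ υ : Memory G} {s t : ℕ} (hP : Exec R S P σ τ s)
      (hQ : Exec R S Q τ υ t) : Exec R S (.seq P Q) σ υ (s + t)
  | iteTrue {T : Test} {P Q : Prog} {σ τ : Memory G} {t : ℕ} (hT : T.holds σ)
      (hP : Exec R S P σ τ t) : Exec R S (.ite T P Q) σ τ (t + 1)
  | iteFalse {T : Test} {P Q : Prog} {σ τ : Memory G} {t : ℕ} (hT : ¬ T.holds σ)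
      (hQ : Exec R S Q σ τ t) : Exec R S (.ite T P Q) σ τ (t + 1)
  | whileFalse {T : Test} {P : Prog} {σ : Memory G} (hT : ¬ T.holds σ) :
      Exec R S (.while T P) σ σ 1
  | whileTrue {T : Test} {P : Prog} {σ τ υ : Memory G} {s t : ℕ} (hT : T.holds σ)
      (hP : Exec R S P σ τ s) (hW : Exec R S (.while T P) τ υ t) :
      Exec R S (.while T P) σ υ (s + t + 1)

/-- Programs are deterministic: result and running time are determined by the input. -/
theorem Exec.deterministic {G : Type*} [Group G] {R : PolycyclicRep G} {S : List G} {P : Prog}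
    {σ τ : Memory G} {t : ℕ} (h : Exec R S P σ τ t) :
    ∀ {τ' : Memory G} {t' : ℕ}, Exec R S P σ τ' t' → τ = τ' ∧ t = t' := by
  induction h with
  | skip => intro _ _ h'; cases h'; simp
  | instr => intro _ _ h'; cases h'; simp
  | seq _ _ ih₁ ih₂ =>
    intro _ _ h'
    cases h' with
    | seq h₁ h₂ =>
      obtain ⟨rfl, rfl⟩ := ih₁ h₁
      obtain ⟨rfl, rfl⟩ := ih₂ h₂
      exact ⟨rfl, rfl⟩
  | iteTrue hT _ ih =>
    intro _ _ h'
    cases h' with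
    | iteTrue _ h₁ => obtain ⟨rfl, rfl⟩ := ih h₁; exact ⟨rfl, rfl⟩
    | iteFalse hF _ => exact absurd hT hF
  | iteFalse hT _ ih =>
    intro _ _ h'
    cases h' with
    | iteTrue hF _ => exact absurd hF hT
    | iteFalse _ h₁ => obtain ⟨rfl, rfl⟩ := ih h₁; exact ⟨rfl, rfl⟩
  | whileFalse hT =>
    intro _ _ h'
    cases h' with
    | whileFalse => exact ⟨rfl, rfl⟩
    | whileTrue hF => exact absurd hF hT
  | whileTrue hT _ _ ih₁ ih₂ =>
    intro _ _ h'
    cases h' with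
    | whileFalse hF => exact absurd hT hF
    | whileTrue _ h₁ h₂ =>
      obtain ⟨rfl, rfl⟩ := ih₁ h₁
      obtain ⟨rfl, rfl⟩ := ih₂ h₂
      exact ⟨rfl, rfl⟩

/-- The initial memory for an instance of the conjugacy search problem: the prime `p`, the number
of given generators and the length of the normal forms in the first integer cells, and the two
elements in the first group cells; all other cells are empty (`0`, respectively `1`). -/
def cspInput {G : Type*} [Group G] (p : ℕ) (R : PolycyclicRep G) (S : List G) (g g' : G) :
    Memory G where
  num := fun i => if i = 0 then p else if i = 1 then S.length else if i = 2 then R.len else 0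
  elt := fun i => if i = 0 then g else if i = 1 then g' else 1

/-!
In an extraspecial group all commutators are central, so `s ↦ [g, s]` is a homomorphism to the
center: if `z = [g, s]`, then conjugation by `s ^ k` multiplies `g` by `z ^ k` (`conj_pow_eq`). If
`g` and `g'` are different conjugates, then `g` is not central, so it fails to commute with some
given generator `s` (`exists_not_commute`). For this `s`, the commutator `z` generates the center,
which has prime order `p` and contains `c = g⁻¹ * g'`. Conjugacy search is thereby reduced to
finding `k` with `z ^ k = c`, and `s ^ k` is then a solution.

This discrete logarithm is easy because of the normal forms (`PolycyclicRep.pow_eq_of_exps`). Let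
`i` be the index of the leading exponent of `z`. The powers of `z` embed into the cyclic factor of
order `r = relOrder R.x i` at the index `i`, as its subgroup of order `p`. So the exponents of `z`
and `c` at `i` are multiples of `r / p`, and `k` is the quotient, modulo `p`, of the two
multipliers. The division is done by raising the denominator to the power `p - 2`.

The search for `s` takes `O(|S|)` steps. The search for `i` takes `O(log |G|)` steps, since the
length of the normal forms is at most `log₂ |G|` (`PolycyclicRep.len_le_log`), and so do the
powers modulo `p` and in the group, by repeated squaring. The running times of the programs are
derived from an invariant for each loop, with `Runs.while`.
-/

/-! ### Running programs within a time bound -/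

/-- A numeral denotes the direct address of the cell with that index. -/
instance (n : ℕ) : OfNat Addr n := ⟨.dir n⟩

@[simp] theorem Memory.loc_ofNat {G : Type*} (σ : Memory G) (n : ℕ) :
    σ.loc (no_index (OfNat.ofNat n : Addr)) = (OfNat.ofNat n : ℕ) := rfl

/-- Straight-line code. -/
def Prog.block : List Instr → Prog
  | [] => .skip
  | I :: L => .seq (.instr I) (.block L)

/-- Started on `σ`, the program `P` halts after at most `n` steps on a memory that satisfies
`Q`. -/
def Runs {G : Type*} [Group G] (R : PolycyclicRep G) (S : List G) (P : Prog) (n : ℕ)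
    (σ : Memory G) (Q : Memory G → Prop) : Prop :=
  ∃ τ t, Exec R S P σ τ t ∧ t ≤ n ∧ Q τ

section Runs

variable {G : Type*} [Group G] {R : PolycyclicRep G} {S : List G}

theorem Exec.block (L : List Instr) (σ : Memory G) :
    Exec R S (.block L) σ (L.foldl (Instr.run R S) σ) L.length := by
  induction L generalizing σ with
  | nil => exact .skip σ
  | cons I L ih => rw [List.length_cons, add_comm]; exact .seq (.instr I σ) (ih _)

theorem Runs.block {L : List Instr} {σ : Memory G} {Q : Memory G → Prop}
    (h : Q (L.foldl (Instr.run R S) σ)) : Runs R S (.block L) L.length σ Q :=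
  ⟨_, _, .block L σ, le_rfl, h⟩

theorem Runs.mono {P : Prog} {σ : Memory G} {m n : ℕ} {Q Q' : Memory G → Prop}
    (h : Runs R S P m σ Q) (hmn : m ≤ n) (hQ : ∀ τ, Q τ → Q' τ) : Runs R S P n σ Q' :=
  let ⟨τ, t, hE, ht, hτ⟩ := h
  ⟨τ, t, hE, ht.trans hmn, hQ τ hτ⟩

theorem Runs.seq {P P' : Prog} {σ : Memory G} {m n : ℕ} {Q Q' : Memory G → Prop}
    (h : Runs R S P m σ Q) (h' : ∀ τ, Q τ → Runs R S P' n τ Q') :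
    Runs R S (.seq P P') (m + n) σ Q' := by
  obtain ⟨τ, s, hE, hs, hτ⟩ := h
  obtain ⟨υ, t, hE', ht, hυ⟩ := h' τ hτ
  exact ⟨υ, s + t, .seq hE hE', by omega, hυ⟩

theorem Runs.ite {T : Test} {P P' : Prog} {σ : Memory G} {n : ℕ} {Q : Memory G → Prop}
    (h : T.holds σ → Runs R S P n σ Q) (h' : ¬ T.holds σ → Runs R S P' n σ Q) :
    Runs R S (.ite T P P') (n + 1) σ Q := by
  by_cases hT : T.holds σ
  · obtain ⟨τ, t, hE, ht, hτ⟩ := h hT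
    exact ⟨τ, t + 1, .iteTrue hT hE, by omega, hτ⟩
  · obtain ⟨τ, t, hE, ht, hτ⟩ := h' hT
    exact ⟨τ, t + 1, .iteFalse hT hE, by omega, hτ⟩

/-- The rule for loops: `I n` is an invariant of the memories from which at most `n` rounds are
left, and every round takes at most `c` steps. -/
theorem Runs.while {T : Test} {P : Prog} {c : ℕ} (I : ℕ → Memory G → Prop)
    (h0 : ∀ σ, I 0 σ → ¬ T.holds σ)
    (hs : ∀ n σ, I (n + 1) σ → T.holds σ → Runs R S P c σ (I n)) (n : ℕ) (σ : Memory G)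
    (h : I n σ) :
    Runs R S (.while T P) (n * (c + 1) + 1) σ fun τ => ¬ T.holds τ ∧ ∃ m ≤ n, I m τ := by
  induction n generalizing σ with
  | zero => exact ⟨σ, 1, .whileFalse (h0 σ h), by omega, h0 σ h, 0, le_rfl, h⟩
  | succ n ih =>
    by_cases hT : T.holds σ
    · obtain ⟨τ, s, hE, hs, hτ⟩ := hs n σ h hT
      obtain ⟨υ, t, hE', ht, hυ, m, hm, hI⟩ := ih τ hτ
      exact ⟨υ, s + t + 1, .whileTrue hT hE hE', by rw [add_mul]; omega, hυ, m, by omega, hI⟩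
    · exact ⟨σ, 1, .whileFalse hT, by omega, hT, n + 1, le_rfl, h⟩

/-! ### The loops of the algorithm -/

/-- Look for a given generator that does not commute with the element in cell `0`. The generator is
left in cell `2`, and its two products with that element are left in the cells `3` and `4`. -/
def findNoncommuting : Prog :=
  .seq (.block [.const 4 1, .readGen 2 3, .mul 3 0 2, .mul 4 2 0])
    (.while (.eqElt 3 4) (.block [.add 3 3 4, .readGen 2 3, .mul 3 0 2, .mul 4 2 0]))

theorem findNoncommuting_runs {σ : Memory G} {j : ℕ} (h3 : σ.num 3 = 0)
    (hj : ¬ Commute (σ.elt 0) (S.getD j 1)) :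
    Runs R S findNoncommuting (5 * j + 5) σ fun τ =>
      (∀ k, k ≠ 3 → k ≠ 4 → τ.num k = σ.num k) ∧ τ.num 4 = 1 ∧
      τ.elt 0 = σ.elt 0 ∧ τ.elt 1 = σ.elt 1 ∧ τ.elt 3 = σ.elt 0 * τ.elt 2 ∧
      τ.elt 4 = τ.elt 2 * σ.elt 0 ∧ ¬ Commute (σ.elt 0) (τ.elt 2) := by
  let I : ℕ → Memory G → Prop := fun n τ => τ.num 3 + n = j ∧ τ.elt 2 = S.getD (τ.num 3) 1 ∧
      (∀ k, k ≠ 3 → k ≠ 4 → τ.num k = σ.num k) ∧ τ.num 4 = 1 ∧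
      τ.elt 0 = σ.elt 0 ∧ τ.elt 1 = σ.elt 1 ∧ τ.elt 3 = σ.elt 0 * τ.elt 2 ∧
      τ.elt 4 = τ.elt 2 * σ.elt 0
  refine Runs.mono (Runs.seq (Q := I j) (Runs.block ?_) fun τ hτ =>
    Runs.while (c := 4) I ?_ ?_ j τ hτ)
    (by simp; omega) ?_
  · simp +contextual [I, Instr.run, Memory.setNum, Memory.setElt, Memory.getNum, Memory.getElt, h3]
  · rintro τ ⟨h, h2, -, -, -, -, h3, h4⟩ hT
    simp only [Test.holds, Memory.getElt, Memory.loc_ofNat, h3, h4, h2] at hT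
    rw [add_zero] at h
    rw [h] at hT
    exact hj hT
  · rintro n τ ⟨h, h2, hn, hn4, h0, h1, h3, h4⟩ -
    refine Runs.block ?_
    simp +contextual [I, Instr.run, Memory.setNum, Memory.setElt, Memory.getNum, Memory.getElt,
      hn4, hn, h0, h1]
    omega
  · rintro τ ⟨hT, m, -, -, -, hn, hn4, h0, h1, h3, h4⟩
    refine ⟨hn, hn4, h0, h1, h3, h4, fun hc => hT ?_⟩
    simpa only [Test.holds, Memory.getElt, Memory.loc_ofNat, h3, h4] using hc.eq

/-- Look for the first non-zero exponent of the element in cell `5`. Its index is left in cell `5`,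
the exponent in cell `6`. -/
def findLeadingExp : Prog :=
  .seq (.block [.readExp 6 5 5])
    (.while (.lt 6 4) (.block [.add 5 5 4, .readExp 6 5 5]))

theorem findLeadingExp_runs {σ : Memory G} {i : Fin R.len} (h4 : σ.num 4 = 1) (h5 : σ.num 5 = 0)
    (hi : R.exps (σ.elt 5) i ≠ 0) (hlt : ∀ j < i, R.exps (σ.elt 5) j = 0) :
    Runs R S findLeadingExp (3 * i + 2) σ fun τ =>
      (∀ k, k ≠ 5 → k ≠ 6 → τ.num k = σ.num k) ∧ τ.elt = σ.elt ∧ τ.num 5 = i ∧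
      τ.num 6 = R.exps (σ.elt 5) i := by
  let I : ℕ → Memory G → Prop := fun n τ => τ.num 5 + n = i ∧ τ.elt = σ.elt ∧
      (∀ k, k ≠ 5 → k ≠ 6 → τ.num k = σ.num k) ∧
      ∀ h : τ.num 5 < R.len, τ.num 6 = R.exps (σ.elt 5) ⟨τ.num 5, h⟩
  have hI : ∀ n τ, I n τ → ¬ τ.num 6 < 1 → n = 0 ∧ τ.num 6 = R.exps (σ.elt 5) i := by
    rintro n τ ⟨h, -, -, h6⟩ hT
    have hlen : τ.num 5 < R.len := by omega
    rw [h6 hlen] at hT ⊢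
    have hn : n = 0 := by
      by_contra hn
      exact hT (by rw [hlt ⟨_, hlen⟩ (Fin.lt_def.2 (by simp; omega))]; exact one_pos)
    subst hn
    exact ⟨rfl, by congr 1; exact Fin.ext h⟩
  refine Runs.mono (Runs.seq (Q := I i) (Runs.block ?_) fun τ hτ =>
    Runs.while (c := 2) I ?_ ?_ i τ hτ)
    (by simp; omega) ?_
  · simp +contextual [I, Instr.run, Memory.setNum, Memory.getNum, Memory.getElt, h5]
  · rintro τ ⟨h, -, hn, h6⟩ hT
    simp only [Test.holds, Memory.getNum, Memory.loc_ofNat, hn 4 (by simp) (by simp), h4] at hT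
    have hlen : τ.num 5 < R.len := by omega
    rw [h6 hlen, Nat.lt_one_iff] at hT
    refine hi ?_
    rw [← hT]
    congr 1
    ext
    simp [← h]
  · rintro n τ ⟨h, he, hn, h6⟩ -
    refine Runs.block ?_
    simp +contextual [I, Instr.run, Memory.setNum, Memory.getNum, Memory.getElt, hn, h4, he]
    omega
  · rintro τ ⟨hT, m, -, hm⟩
    simp only [Test.holds, Memory.getNum, Memory.loc_ofNat, hm.2.2.1 4 (by simp) (by simp),
      h4] at hT
    obtain ⟨rfl, h6⟩ := hI m τ hm hT
    exact ⟨hm.2.2.1, hm.2.1, hm.1, h6⟩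

/-- Square and multiply modulo the integer in cell `0`: multiply the integer in cell `7` by the
power of the integer in cell `6` whose exponent is in cell `11`. Cell `12` holds the constant `2`
and cell `13` the constant `0`. -/
def powMod : Prog :=
  .while (.lt 13 11) (.seq (.block [.mod 14 11 12])
    (.seq (.ite (.lt 13 14) (.block [.mulMod 7 7 6 0]) .skip)
      (.block [.mulMod 6 6 6 0, .div 11 11 12])))

theorem powMod_runs {σ : Memory G} {p n : ℕ} (hp : σ.num 0 = p) (h7 : σ.num 7 < p)
    (h12 : σ.num 12 = 2) (h13 : σ.num 13 = 0) (h11 : σ.num 11 < 2 ^ n) :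
    Runs R S powMod (6 * n + 1) σ fun τ =>
      τ.elt = σ.elt ∧ τ.num 12 = 2 ∧ τ.num 13 = 0 ∧ τ.num 7 < p ∧
      (τ.num 7 : ZMod p) = σ.num 7 * σ.num 6 ^ σ.num 11 := by
  let I : ℕ → Memory G → Prop := fun n τ => τ.num 11 < 2 ^ n ∧ τ.num 0 = p ∧
    τ.elt = σ.elt ∧ τ.num 12 = 2 ∧ τ.num 13 = 0 ∧ τ.num 7 < p ∧
    (τ.num 7 : ZMod p) * τ.num 6 ^ τ.num 11 = σ.num 7 * σ.num 6 ^ σ.num 11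
  have hp0 : p ≠ 0 := by omega
  refine Runs.mono (Runs.while (c := 5) I ?_ ?_ n σ ⟨h11, hp, rfl, h12, h13, h7, rfl⟩)
    (by omega) ?_
  · rintro τ ⟨h, -⟩ hT
    simp only [Test.holds, Memory.getNum, Memory.loc_ofNat] at hT
    rw [pow_zero] at h
    omega
  · rintro n τ ⟨h, h0, he, h12, h13, h7, hv⟩ -
    have hpow := Nat.div_add_mod (τ.num 11) 2
    have hlt : τ.num 11 / 2 < 2 ^ n := by rw [pow_succ] at h; omega
    refine Runs.mono (m := 1 + (1 + 1 + 2))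
      (Runs.seq (Q := fun υ => υ = τ.setNum 14 (τ.num 11 % 2)) (Runs.block ?_) ?_) (by simp)
      (fun _ h => h)
    · simp [Instr.run, Memory.getNum, h12]
    · rintro _ rfl
      refine Runs.seq (Q := fun υ => υ.num 11 = τ.num 11 ∧ υ.num 6 = τ.num 6 ∧ υ.num 0 = p ∧
        υ.elt = σ.elt ∧ υ.num 12 = 2 ∧ υ.num 13 = 0 ∧ υ.num 7 < p ∧
        (υ.num 7 : ZMod p) = τ.num 7 * τ.num 6 ^ (τ.num 11 % 2))
        (Runs.ite (fun hT => Runs.block ?_) fun hT => ⟨_, 0, .skip _, by simp, ?_⟩) ?_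
      · simp [Test.holds, Memory.setNum, Memory.getNum, h13] at hT
        have h1 : τ.num 11 % 2 = 1 := by omega
        simp [Instr.run, Memory.setNum, Memory.getNum, *, Nat.mod_lt, Nat.pos_of_ne_zero hp0]
      · simp [Test.holds, Memory.setNum, Memory.getNum, h13] at hT
        simp [Memory.setNum, *]
      · rintro υ ⟨k11, k6, k0, ke, k12, k13, k7, kv⟩
        refine Runs.block ?_
        simp [I, Instr.run, Memory.setNum, Memory.getNum, *]
        rw [← hv]
        conv_rhs => rw [← hpow, pow_add, pow_mul]
        ring
  · rintro τ ⟨hT, m, -, -, h0, he, h12, h13, h7, hv⟩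
    simp only [Test.holds, Memory.getNum, Memory.loc_ofNat] at hT
    have h11 : τ.num 11 = 0 := by omega
    rw [h11, pow_zero, mul_one] at hv
    exact ⟨he, h12, h13, h7, hv⟩

/-- Square and multiply in the group: multiply the element in cell `0` by the power of the element
in cell `2` whose exponent is in cell `7`. Cell `12` holds the constant `2` and cell `13` the
constant `0`. -/
def powElt : Prog :=
  .while (.lt 13 7) (.seq (.block [.mod 14 7 12])
    (.seq (.ite (.lt 13 14) (.block [.mul 0 0 2]) .skip)
      (.block [.mul 2 2 2, .div 7 7 12])))

theorem powElt_runs {σ : Memory G} {n : ℕ} (h12 : σ.num 12 = 2) (h13 : σ.num 13 = 0)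
    (h7 : σ.num 7 < 2 ^ n) :
    Runs R S powElt (6 * n + 1) σ fun τ => τ.elt 0 = σ.elt 0 * σ.elt 2 ^ σ.num 7 := by
  let I : ℕ → Memory G → Prop := fun n τ => τ.num 7 < 2 ^ n ∧ τ.num 12 = 2 ∧ τ.num 13 = 0 ∧
    τ.elt 0 * τ.elt 2 ^ τ.num 7 = σ.elt 0 * σ.elt 2 ^ σ.num 7
  refine Runs.mono (Runs.while (c := 5) I ?_ ?_ n σ ⟨h7, h12, h13, rfl⟩) (by omega) ?_
  · rintro τ ⟨h, -⟩ hT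
    simp only [Test.holds, Memory.getNum, Memory.loc_ofNat] at hT
    rw [pow_zero] at h
    omega
  · rintro n τ ⟨h, h12, h13, hv⟩ -
    have hpow := Nat.mod_add_div (τ.num 7) 2
    have hlt : τ.num 7 / 2 < 2 ^ n := by rw [pow_succ] at h; omega
    refine Runs.mono (m := 1 + (1 + 1 + 2))
      (Runs.seq (Q := fun υ => υ = τ.setNum 14 (τ.num 7 % 2)) (Runs.block ?_) ?_) (by simp)
      (fun _ h => h)
    · simp [Instr.run, Memory.getNum, h12]
    · rintro _ rfl
      refine Runs.seq (Q := fun υ => υ.num 7 = τ.num 7 ∧ υ.elt 2 = τ.elt 2 ∧ υ.num 12 = 2 ∧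
        υ.num 13 = 0 ∧ υ.elt 0 = τ.elt 0 * τ.elt 2 ^ (τ.num 7 % 2))
        (Runs.ite (fun hT => Runs.block ?_) fun hT => ⟨_, 0, .skip _, by simp, ?_⟩) ?_
      · simp [Test.holds, Memory.setNum, Memory.getNum, h13] at hT
        have h1 : τ.num 7 % 2 = 1 := by omega
        simp [Instr.run, Memory.setNum, Memory.setElt, Memory.getElt, *]
      · simp [Test.holds, Memory.setNum, Memory.getNum, h13] at hT
        simp [Memory.setNum, *]
      · rintro υ ⟨k7, k2, k12, k13, kv⟩
        refine Runs.block ?_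
        simp [I, Instr.run, Memory.setNum, Memory.setElt, Memory.getNum, Memory.getElt, *]
        rw [← hv]
        conv_rhs => rw [← hpow, pow_add, pow_mul, pow_two]
        rw [mul_assoc]
  · rintro τ ⟨hT, m, -, -, h12, h13, hv⟩
    simp only [Test.holds, Memory.getNum, Memory.loc_ofNat] at hT
    have h7 : τ.num 7 = 0 := by omega
    rwa [h7, pow_zero, mul_one] at hv

end Runs

/-! ### Normal forms -/

section NormalForms

variable {G : Type*} [Group G]

theorem tailSubgroup_antitone {n : ℕ} (x : Fin n → G) : Antitone (tailSubgroup x) :=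
  fun _ _ h => Subgroup.closure_mono fun _ ⟨i, hi, hx⟩ => ⟨i, h.trans hi, hx⟩

theorem mem_tailSubgroup {n : ℕ} (x : Fin n → G) {i : Fin n} {k : ℕ} (h : k ≤ i) :
    x i ∈ tailSubgroup x k :=
  Subgroup.subset_closure ⟨i, h, rfl⟩

namespace PolycyclicRep

variable (R : PolycyclicRep G)

theorem tailSubgroup_zero : tailSubgroup R.x 0 = ⊤ := by
  refine eq_top_iff.2 fun g _ => ?_
  rw [← R.prod_exps g]
  refine Subgroup.list_prod_mem _ fun y hy => ?_
  obtain ⟨i, rfl⟩ := List.mem_ofFn.1 hy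
  exact pow_mem (mem_tailSubgroup R.x (Nat.zero_le _)) _

/-- The factor `G i / G (i + 1)` is cyclic of order `relOrder R.x i`, generated by `x i`. -/
theorem relOrder_dvd {i : Fin R.len} {n : ℕ} (h : R.x i ^ n ∈ tailSubgroup R.x (i + 1)) :
    relOrder R.x i ∣ n := by
  have := R.normal i
  set H := tailSubgroup R.x i
  set N := (tailSubgroup R.x (i + 1)).subgroupOf H
  let y : H := ⟨R.x i, mem_tailSubgroup R.x le_rfl⟩
  have hy : ∀ u : H ⧸ N, u ∈ Subgroup.zpowers (y : H ⧸ N) := by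
    have hle : H ≤ ((Subgroup.zpowers (y : H ⧸ N)).comap (QuotientGroup.mk' N)).map H.subtype := by
      refine (Subgroup.closure_le _).2 ?_
      rintro _ ⟨j, hj, rfl⟩
      refine ⟨⟨R.x j, mem_tailSubgroup R.x hj⟩, ?_, rfl⟩
      obtain hij | hij := hj.eq_or_lt
      · obtain rfl := Fin.ext hij
        exact Subgroup.mem_zpowers (y : H ⧸ N)
      · rw [SetLike.mem_coe, Subgroup.mem_comap, QuotientGroup.mk'_apply,
          (QuotientGroup.eq_one_iff (N := N) ⟨R.x j, _⟩).2
            (Subgroup.mem_subgroupOf.2 (mem_tailSubgroup R.x hij))]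
        exact one_mem _
    intro u
    obtain ⟨h, rfl⟩ := QuotientGroup.mk_surjective u
    obtain ⟨h', hm, hh⟩ := hle h.2
    obtain rfl : h' = h := Subtype.ext hh
    exact hm
  have hN : (y : H ⧸ N) ^ n = 1 := by
    rw [← QuotientGroup.mk_pow, QuotientGroup.eq_one_iff]
    exact Subgroup.mem_subgroupOf.2 h
  have := orderOf_eq_card_of_forall_mem_zpowers hy
  rw [relOrder, Subgroup.relIndex, Subgroup.index, ← this]
  exact orderOf_dvd_of_pow_eq_one hN

/-- An element whose exponents before the index `i` vanish is congruent to the power of `x i` in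
its normal form, modulo the elements that come later in the sequence. -/
theorem pow_exps_inv_mul_mem {g : G} {i : Fin R.len} (h : ∀ j < i, R.exps g j = 0) :
    (R.x i ^ R.exps g i)⁻¹ * g ∈ tailSubgroup R.x (i + 1) := by
  have key : ∀ (L : List (Fin R.len)), L.Pairwise (· < ·) → i ∈ L →
      (R.x i ^ R.exps g i)⁻¹ * (L.map fun j => R.x j ^ R.exps g j).prod ∈
        tailSubgroup R.x (i + 1) := by
    intro L hL hi
    induction L with
    | nil => simp at hi
    | cons j L ih =>
      rw [List.pairwise_cons] at hL
      rw [List.map_cons, List.prod_cons]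
      obtain rfl | hi := List.mem_cons.1 hi
      · rw [inv_mul_cancel_left]
        refine Subgroup.list_prod_mem _ fun y hy => ?_
        obtain ⟨k, hk, rfl⟩ := List.mem_map.1 hy
        exact pow_mem (mem_tailSubgroup R.x (hL.1 k hk)) _
      · rw [h j (hL.1 i hi), pow_zero, one_mul]
        exact ih hL.2 hi
  have := key (List.finRange R.len) (List.pairwise_lt_finRange _) (List.mem_finRange i)
  rwa [← List.ofFn_eq_map, R.prod_exps] at this

theorem mem_tailSubgroup_of_exps {g : G} {i : Fin R.len} (h : ∀ j < i, R.exps g j = 0) :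
    g ∈ tailSubgroup R.x i := by
  have h1 := tailSubgroup_antitone R.x (Nat.le_succ i) (R.pow_exps_inv_mul_mem h)
  have h2 := pow_mem (mem_tailSubgroup R.x (le_refl (i : ℕ))) (R.exps g i)
  simpa using mul_mem h2 h1

theorem exps_eq_zero_of_mem {g : G} {k : ℕ} (hg : g ∈ tailSubgroup R.x k) (j : Fin R.len)
    (hj : (j : ℕ) < k) : R.exps g j = 0 := by
  induction j using WellFoundedLT.induction with
  | _ j ih =>
    have h1 := R.pow_exps_inv_mul_mem (g := g) (i := j) fun l hl => ih l hl (by omega)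
    have h2 := (Subgroup.mul_mem_cancel_right _ (tailSubgroup_antitone R.x hj hg)).1 h1
    exact Nat.eq_zero_of_dvd_of_lt (R.relOrder_dvd (inv_mem_iff.1 h2)) (R.exps_lt g j)

theorem len_le_log [Finite G] : R.len ≤ Nat.log 2 (Nat.card G) := by
  have key : ∀ m k, m + k = R.len → 2 ^ m ≤ Nat.card (tailSubgroup R.x k) := by
    intro m
    induction m with
    | zero => exact fun k _ => Nat.card_pos
    | succ m ih =>
      intro k hk
      have h1 := R.one_lt_relOrder ⟨k, by omega⟩
      have h2 := Subgroup.relIndex_mul_relIndex ⊥ _ _ bot_le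
        (tailSubgroup_antitone R.x (Nat.le_succ k))
      rw [Subgroup.relIndex_bot_left, Subgroup.relIndex_bot_left] at h2
      rw [← h2, pow_succ]
      exact Nat.mul_le_mul (ih (k + 1) (by omega)) h1
  have h := key R.len 0 rfl
  rw [R.tailSubgroup_zero, Subgroup.card_top] at h
  exact Nat.le_log_of_pow_le one_lt_two h

/-- Discrete logarithms of an element `z` of prime order `p` are read off the normal forms. At the
index `i` of the leading exponent of `z`, the multiples of `r / p` modulo `r = relOrder R.x i` carry
the powers of `z`, so that the logarithm is a quotient of exponents modulo `p`; the inverse of the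
denominator is its power with exponent `p - 2`. -/
theorem pow_eq_of_exps {p : ℕ} (hp : p.Prime) {z c : G} (hz : z ^ p = 1)
    (hc : c ∈ Subgroup.zpowers z) {i : Fin R.len} (hi : R.exps z i ≠ 0)
    (hlt : ∀ j < i, R.exps z j = 0) :
    R.exps c i / (relOrder R.x i / p) < p ∧
    ∀ k : ℕ, (k : ZMod p) = (R.exps c i / (relOrder R.x i / p) : ℕ) *
      (R.exps z i / (relOrder R.x i / p) : ℕ) ^ (p - 2) → z ^ k = c := by
  have := Fact.mk hp
  set r := relOrder R.x i
  have hz' := R.mem_tailSubgroup_of_exps hlt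
  have := R.normal i
  set H := tailSubgroup R.x i
  set N := (tailSubgroup R.x (i + 1)).subgroupOf H
  let π : H →* H ⧸ N := QuotientGroup.mk' N
  let y : H := ⟨R.x i, mem_tailSubgroup R.x le_rfl⟩
  -- all congruences are computed in the factor `H ⧸ N`, generated by `π y`
  have hπ : ∀ (g : G) (hg : g ∈ H), π ⟨g, hg⟩ = π y ^ R.exps g i := by
    intro g hg
    rw [← map_pow, eq_comm]
    refine QuotientGroup.eq.2 (Subgroup.mem_subgroupOf.2 ?_)
    exact R.pow_exps_inv_mul_mem fun j hj => R.exps_eq_zero_of_mem hg j hj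
  have hy : ∀ n : ℕ, π y ^ n = 1 → r ∣ n := by
    intro n hn
    rw [← map_pow] at hn
    exact R.relOrder_dvd (Subgroup.mem_subgroupOf.1 ((QuotientGroup.eq_one_iff (N := N) _).1 hn))
  have hyo : r ∣ orderOf (π y) := hy _ (pow_orderOf_eq_one _)
  have hfin : 0 < r := one_pos.trans (R.one_lt_relOrder i)
  obtain ⟨m, rfl⟩ : ∃ m : ℕ, z ^ m = c := by
    have hfo : IsOfFinOrder z := isOfFinOrder_iff_pow_eq_one.2 ⟨p, hp.pos, hz⟩
    exact (hfo.mem_powers_iff_mem_zpowers.2 hc)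
  have h1 : r ∣ R.exps z i * p := by
    refine hy _ ?_
    rw [pow_mul, ← hπ z hz', ← map_pow]
    exact (congrArg π (Subtype.ext hz)).trans (map_one π)
  have hzr : R.exps z i < r := R.exps_lt z i
  have hcr : R.exps (z ^ m) i < r := R.exps_lt _ i
  have hpr : p ∣ r := by
    by_contra hpr
    have := ((Nat.Prime.coprime_iff_not_dvd hp).2 hpr).symm.dvd_of_dvd_mul_right h1
    exact hi (Nat.eq_zero_of_dvd_of_lt this hzr)
  obtain ⟨q, hq⟩ := hpr
  have hq0 : 0 < q := Nat.pos_of_ne_zero fun h => by simp [h] at hq; omega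
  rw [hq, Nat.mul_div_cancel_left _ hp.pos]
  rw [hq] at hzr hcr h1
  obtain ⟨a, ha⟩ : q ∣ R.exps z i := by
    rw [mul_comm] at h1
    exact Nat.dvd_of_mul_dvd_mul_right hp.pos h1
  have h2 : R.exps (z ^ m) i ≡ R.exps z i * m [MOD p * q] := by
    rw [← hq]
    refine Nat.ModEq.of_dvd hyo (pow_eq_pow_iff_modEq.1 ?_)
    rw [pow_mul, ← hπ z hz', ← hπ (z ^ m) (pow_mem hz' m), ← map_pow]
    rfl
  obtain ⟨b, hb⟩ : q ∣ R.exps (z ^ m) i := by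
    rw [(h2.of_dvd (dvd_mul_left q p)).dvd_iff dvd_rfl, ha, mul_assoc]
    exact dvd_mul_right _ _
  rw [ha, hb, mul_comm p q, mul_assoc] at h2
  have h3 : b ≡ a * m [MOD p] := Nat.ModEq.mul_left_cancel' hq0.ne' h2
  rw [ha, hb, Nat.mul_div_cancel_left _ hq0, Nat.mul_div_cancel_left _ hq0]
  rw [ha, mul_comm p] at hzr
  rw [hb, mul_comm p] at hcr
  refine ⟨Nat.lt_of_mul_lt_mul_left hcr, fun k hk => ?_⟩
  have ha0 : (a : ZMod p) ≠ 0 := by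
    rw [Ne, ZMod.natCast_eq_zero_iff]
    intro h
    refine hi ?_
    rw [ha, Nat.eq_zero_of_dvd_of_lt h (Nat.lt_of_mul_lt_mul_left hzr), mul_zero]
  have h4 : (k : ZMod p) = m := by
    rw [hk, (ZMod.natCast_eq_natCast_iff b (a * m) p).2 h3, Nat.cast_mul, mul_comm (a : ZMod p),
      mul_assoc, ← pow_succ']
    have hf := ZMod.pow_card_sub_one_eq_one ha0
    rw [show p - 2 + 1 = p - 1 by have := hp.two_le; omega, hf, mul_one]
  exact pow_eq_pow_iff_modEq.2
    (((ZMod.natCast_eq_natCast_iff k m p).1 h4).of_dvd (orderOf_dvd_of_pow_eq_one hz))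

end PolycyclicRep

end NormalForms

/-! ### Commutators in extraspecial groups -/

namespace IsExtraspecial

variable {p : ℕ} {G : Type*} [Group G]

theorem inv_mul_conj_mem_center (hG : IsExtraspecial p G) (g s : G) :
    g⁻¹ * (s⁻¹ * g * s) ∈ Subgroup.center G := by
  rw [← QuotientGroup.eq, QuotientGroup.mk_mul, QuotientGroup.mk_mul,
    hG.comm_quotient _ (g : G ⧸ Subgroup.center G), mul_assoc, ← QuotientGroup.mk_mul,
    inv_mul_cancel, QuotientGroup.mk_one, mul_one]

theorem pow_eq_one_of_mem_center (hG : IsExtraspecial p G) {z : G}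
    (hz : z ∈ Subgroup.center G) : z ^ p = 1 := by
  have := pow_card_eq_one' (x := (⟨z, hz⟩ : Subgroup.center G))
  rw [hG.card_center] at this
  exact congrArg Subtype.val this

theorem mem_zpowers_of_mem_center (hG : IsExtraspecial p G) (hp : p.Prime) {z c : G}
    (hz : z ∈ Subgroup.center G) (hz1 : z ≠ 1) (hc : c ∈ Subgroup.center G) :
    c ∈ Subgroup.zpowers z := by
  have := Fact.mk hp
  obtain ⟨n, hn⟩ := mem_zpowers_of_prime_card hG.card_center (g := ⟨z, hz⟩) (g' := ⟨c, hc⟩)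
    fun h => hz1 (congrArg Subtype.val h)
  exact ⟨n, congrArg Subtype.val hn⟩

theorem log_le_log_card (hG : IsExtraspecial p G) : Nat.log 2 p ≤ Nat.log 2 (Nat.card G) := by
  have := hG.finite
  refine Nat.log_mono_right ?_
  rw [← hG.card_center]
  exact Nat.le_of_dvd Nat.card_pos (Subgroup.card_subgroup_dvd_card _)

end IsExtraspecial

/-- If conjugation by `s` multiplies `g` by a central element, then conjugation by a power of `s`
multiplies `g` by the power of that element. -/
theorem conj_pow_eq {G : Type*} [Group G] {g s z : G} (hz : z ∈ Subgroup.center G)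
    (h : s⁻¹ * g * s = g * z) (k : ℕ) : (s ^ k)⁻¹ * g * s ^ k = g * z ^ k := by
  induction k with
  | zero => simp
  | succ k ih =>
    have hzs : s⁻¹ * g * s * (s⁻¹ * z ^ k * s) = g * z * z ^ k := by
      rw [h, mul_assoc s⁻¹, ← Subgroup.mem_center_iff.1 (pow_mem hz k) s, inv_mul_cancel_left]
    calc (s ^ (k + 1))⁻¹ * g * s ^ (k + 1) = s⁻¹ * ((s ^ k)⁻¹ * g * s ^ k) * s := by
          rw [pow_succ]; group
      _ = s⁻¹ * g * s * (s⁻¹ * z ^ k * s) := by rw [ih]; group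
      _ = g * z ^ (k + 1) := by rw [hzs, mul_assoc, ← pow_succ']

theorem exists_not_commute {G : Type*} [Group G] {S : List G}
    (hS : Subgroup.closure {s | s ∈ S} = ⊤) {g : G} (hg : g ∉ Subgroup.center G) :
    ∃ j < S.length, ¬ Commute g (S.getD j 1) := by
  by_contra! h
  have hle : Subgroup.closure {s | s ∈ S} ≤ Subgroup.centralizer {g} := by
    refine (Subgroup.closure_le _).2 fun s hs => ?_
    obtain ⟨j, hj, rfl⟩ := List.getElem_of_mem hs
    have := h j hj
    rw [List.getD_eq_getElem _ _ hj] at this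
    exact Subgroup.mem_centralizer_singleton_iff.2 this.symm
  rw [hS] at hle
  refine hg (Subgroup.mem_center_iff.2 fun s => ?_)
  exact Subgroup.mem_centralizer_singleton_iff.1 (hle (Subgroup.mem_top s))

/-! ### Conjugacy search -/

/-- The group cells `5` and `6` hold the commutator `z = [g, s]` and `c = g⁻¹ * g'`, the integer
cells `5` and `6` the index and the value of the leading exponent of `z`. Put the numbers whose
quotient modulo `p` is the logarithm of `c` to the base `z` in the integer cells `7` and `6`, and
the exponent `p - 2` that inverts the latter in the integer cell `11`. -/
def readLog : Prog :=
  .block [.readExp 7 6 5, .readOrder 8 5, .div 8 8 0, .div 6 6 8, .div 7 7 8, .const 12 2,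
    .sub 11 0 12]

/-- Conjugacy search in an extraspecial group. -/
def conjSearch : Prog :=
  .ite (.eqElt 0 1) (.block [.one 0])
    (.seq findNoncommuting (.seq (.block [.inv 5 4, .mul 5 5 3, .inv 6 0, .mul 6 6 1])
      (.seq findLeadingExp (.seq readLog (.seq powMod (.seq (.block [.one 0]) powElt))))))

theorem conjSearch_runs {p : ℕ} (hp : p.Prime) {G : Type*} [Group G] (hG : IsExtraspecial p G)
    (R : PolycyclicRep G) {S : List G} (hS : Subgroup.closure {s | s ∈ S} = ⊤) {g g' : G}
    (h : IsConj g g') :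
    Runs R S conjSearch (50 * (S.length + Nat.log 2 (Nat.card G))) (cspInput p R S g g')
      fun τ => (τ.elt 0)⁻¹ * g * τ.elt 0 = g' := by
  have := hG.finite
  have hlog : 0 < Nat.log 2 p := Nat.log_pos one_lt_two hp.two_le
  have hlog' := hG.log_le_log_card
  obtain ⟨u, hu⟩ := isConj_iff.1 h
  by_cases hgg : g = g'
  · refine Runs.mono (Runs.ite (fun _ => Runs.block ?_) fun hT => ?_) (n := _) ?_ fun _ h => h
    · simp [Instr.run, Memory.setElt, hgg]
    · simp [Test.holds, Memory.getElt, cspInput, hgg] at hT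
    · simp; omega
  have hcen : g ∉ Subgroup.center G := fun hg => hgg <| by
    rw [← hu, Subgroup.mem_center_iff.1 hg u, mul_inv_cancel_right]
  have hc : g⁻¹ * g' ∈ Subgroup.center G := by
    have := hG.inv_mul_conj_mem_center g u⁻¹
    rwa [inv_inv, hu] at this
  obtain ⟨j, hj, hcomm⟩ := exists_not_commute hS hcen
  set L := Nat.log 2 (Nat.card G)
  have hlen := R.len_le_log
  obtain ⟨n, hn⟩ : ∃ n, n = Nat.log 2 p + 1 := ⟨_, rfl⟩
  have hpn : p < 2 ^ n := hn ▸ Nat.lt_pow_succ_log_self one_lt_two p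
  -- `L` is positive, so the factor `50` also covers the constant terms
  refine Runs.mono (m := max 1 (5 * j + 5 + (4 + (3 * L + 2 + (7 + (6 * n + 1 +
    (1 + (6 * n + 1))))))) + 1) (Runs.ite (fun hT => ?_) fun _ => Runs.mono ?_ (le_max_right _ _)
    fun _ h => h) (by omega) fun _ h => h
  · exact absurd (by simpa [Test.holds, Memory.getElt, cspInput] using hT) hgg
  refine Runs.seq (findNoncommuting_runs (σ := cspInput p R S g g') rfl hcomm) ?_
  rintro σ ⟨hσ, hσ4, e0, e1, e3, e4, hs⟩
  simp only [cspInput, if_true, one_ne_zero, if_false] at e0 e1 e3 e4 hs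
  have hσ0 : σ.num 0 = p := hσ 0 (by simp) (by simp)
  have hσ5 : σ.num 5 = 0 := hσ 5 (by simp) (by simp)
  have hσ13 : σ.num 13 = 0 := hσ 13 (by simp) (by simp)
  clear hσ
  generalize hs' : σ.elt 2 = s at *
  set z := g⁻¹ * (s⁻¹ * g * s) with hz
  have hzc : z ∈ Subgroup.center G := hG.inv_mul_conj_mem_center g s
  have hz1 : z ≠ 1 := fun h => hs <| by
    rw [hz, mul_assoc s⁻¹, inv_mul_eq_one, eq_inv_mul_iff_mul_eq] at h
    exact h.symm
  refine Runs.seq (Q := fun τ => τ.num = σ.num ∧ τ.elt 2 = s ∧ τ.elt 5 = z ∧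
    τ.elt 6 = g⁻¹ * g') (Runs.block ?_) ?_
  · simp [Instr.run, Memory.setElt, Memory.getElt, *, mul_assoc]
  rintro τ ⟨hτ, e2, e5, e6⟩
  clear e0 e1 e3 e4
  -- the leading exponent of `z`
  obtain ⟨i, hi, hlt⟩ : ∃ i, R.exps z i ≠ 0 ∧ ∀ j < i, R.exps z j = 0 := by
    have hex : ∃ i, R.exps z i ≠ 0 := by
      by_contra! h0
      refine hz1 ?_
      rw [← R.prod_exps z]
      simp [h0]
    obtain ⟨i, hi, hmin⟩ := WellFounded.has_min (wellFounded_lt (α := Fin R.len))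
      {i | R.exps z i ≠ 0} hex
    exact ⟨i, hi, fun j hj => by_contra fun h0 => hmin j h0 hj⟩
  obtain ⟨hb, hk⟩ := R.pow_eq_of_exps hp (hG.pow_eq_one_of_mem_center hzc)
    (hG.mem_zpowers_of_mem_center hp hzc hz1 hc) hi hlt
  refine Runs.seq (Runs.mono (findLeadingExp_runs (σ := τ) (i := i) (by rw [hτ, hσ4])
    (by rw [hτ, hσ5]) (by rwa [e5]) (by rwa [e5])) (by omega) fun _ h => h) ?_
  rintro υ ⟨hυ, he, hυ5, hυ6⟩
  have hυ0 : υ.num 0 = p := by rw [hυ 0 (by simp) (by simp), hτ, hσ0]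
  have hυ13 : υ.num 13 = 0 := by rw [hυ 13 (by simp) (by simp), hτ, hσ13]
  rw [e5] at hυ6
  refine Runs.seq (Q := fun ω => ω.num 0 = p ∧ ω.num 12 = 2 ∧ ω.num 13 = 0 ∧ ω.num 11 = p - 2 ∧
    ω.num 7 = R.exps (g⁻¹ * g') i / (relOrder R.x i / p) ∧
    ω.num 6 = R.exps z i / (relOrder R.x i / p) ∧ ω.elt 2 = s) (Runs.block ?_) ?_
  · simp [Instr.run, Memory.setNum, Memory.getNum, Memory.getElt, *]
  rintro ω ⟨h0, h12, h13, h11, h7, h6, f2⟩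
  refine Runs.seq (powMod_runs (n := n) h0 (by rwa [h7]) h12 h13 (by omega)) ?_
  rintro ρ ⟨he, h12, h13, hlt, hv⟩
  rw [h7, h6, h11] at hv
  refine Runs.seq (Q := fun χ => χ.elt 0 = 1 ∧ χ.elt 2 = s ∧ χ.num = ρ.num) (Runs.block ?_) ?_
  · simp [Instr.run, Memory.setElt, *]
  rintro χ ⟨x0, x2, hχ⟩
  refine Runs.mono (powElt_runs (n := n) (by rw [hχ, h12]) (by rw [hχ, h13])
    (by rw [hχ]; omega)) le_rfl ?_
  intro φ hφ
  rw [hφ, x0, x2, one_mul, hχ, conj_pow_eq hzc (by rw [hz, mul_inv_cancel_left]), hk _ hv,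
    mul_inv_cancel_left]

/-- The conjugacy search problem in extraspecial `p`-groups, given by generators, has a polynomial
time solution: one program solves it for all extraspecial groups, in `O(|S| + log |G|)` steps
(hence `O(log |G|)` steps if the generating list `S` is irredundant). -/
theorem mainTheorem5 :
    ∃ (P : Prog) (C : ℕ), ∀ (p : ℕ), p.Prime →
      ∀ (G : Type*) [Group G], IsExtraspecial p G →
      ∀ (R : PolycyclicRep G) (S : List G), Subgroup.closure {s | s ∈ S} = ⊤ →
      ∀ g g' : G, IsConj g g' →
        ∃ (τ : Memory G) (t : ℕ),
          Exec R S P (cspInput p R S g g') τ t ∧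
          t ≤ C * (S.length + Nat.log 2 (Nat.card G)) ∧
          (τ.elt 0)⁻¹ * g * τ.elt 0 = g' :=
  ⟨conjSearch, 50, fun _ hp _ _ hG R _ hS _ _ h => conjSearch_runs hp hG R hS h⟩
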